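/- Let $k$ be a field with $\operatorname{char} k\ne 2,3$, let $\Gamma$ be an abelian group, and let $\varepsilon:\Gamma\times\Gamma\to k\setminus\{0\}$ be a commutation factor, i.e. a map that is multiplicative in each argument and satisfies $\varepsilon(\alpha,\beta)\varepsilon(\beta,\alpha)=1$. A color Lie algebra is a $\Gamma$-graded vector space $g=\bigoplus_{\gamma\in\Gamma} g_\gamma$ with a bilinear bracket such that $\langle g_\alpha,g_\beta\rangle\subseteq g_{\alpha+\beta}$, and for $a\in g_\alpha$, $b\in g_\beta$, $c\in g_\gamma$ one has $\langle a,b\rangle=-\varepsilon(\alpha,\beta)\langle b,a\rangle$ and $$\varepsilon(\gamma,\alpha)\langle a,\langle b,c\rangle\rangle+\varepsilon(\beta,\gamma)\langle c,\langle a,b\rangle\rangle+\varepsilon(\alpha,\beta)\langle b,\langle c,a\rangle\rangle=0.$$ It is abelian if its bracket is zero. Its universal enveloping algebra $U(g)$ is the quotient of the tensor algebra $T(g)$ by the relations $ab-\varepsilon(\alpha,\beta)ba=\langle a,b\rangle$ for $a\in g_\alpha$, $b\in g_\beta$. Let $g$ be a finite-dimensional abelian color Lie algebra and $R=U(g)$.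 For $n\ge 0$ let $R_n$ be the span of the products of $n$ elements of the image of $g$ (with $R_0$ the span of $1$). Then $R$, with the components $R_n$, is a homogeneous Koszul algebra, that is: 1. $R$ is a standard algebra: $R=\bigoplus_{n\ge 0}R_n$ is a graded algebra with finite-dimensional components, $R_0=k$, and $R$ is generated by $R_1$ and the unit; 2. the trivial right module $k_R=R/R_+$, where $R_+=\bigoplus_{n>0}R_n$, has a linear free resolution, i.e. a graded free resolution $\cdots\to P_1\to P_0\to k_R\to 0$ in which $P_i$ is free of finite rank on generators of degree $i$; equivalently, for every $i\ge 0$ the graded vector space $H_iR=\operatorname{Tor}_i^R(k,k)$ (computed by any graded free resolution of $k_R$) is concentrated in degree $i$. -/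

import Mathlib

/-! ### Color Lie algebras and their universal enveloping algebras -/

/-- A commutation factor on the abelian group `Γ` with values in `k \ {0}`. -/
structure CommutationFactor (k Γ : Type*) [Field k] [AddCommGroup Γ] where
  /-- the underlying map `Γ × Γ → k \ {0}` -/
  toFun : Γ → Γ → kˣ
  map_add_left : ∀ α β γ, toFun (α + β) γ = toFun α γ * toFun β γ
  map_add_right : ∀ α β γ, toFun α (β + γ) = toFun α β * toFun α γ
  mul_swap : ∀ α β, toFun α β * toFun β α = 1

/-- The structure of a `Γ`-graded `ε`-Lie algebra (a color Lie algebra) on the vector space `L`. -/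
structure ColorLieAlgebra {k Γ : Type*} [Field k] [AddCommGroup Γ] [DecidableEq Γ]
    (ε : CommutationFactor k Γ) (L : Type*) [AddCommGroup L] [Module k L] where
  /-- the homogeneous components -/
  component : Γ → Submodule k L
  isInternal : DirectSum.IsInternal component
  /-- the bilinear bracket -/
  bracket : L →ₗ[k] L →ₗ[k] L
  bracket_mem : ∀ α β, ∀ a ∈ component α, ∀ b ∈ component β,
    bracket a b ∈ component (α + β)
  bracket_skew : ∀ α β, ∀ a ∈ component α, ∀ b ∈ component β,
    bracket a b = -((ε.toFun α β : k) • bracket b a)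
  jacobi : ∀ α β γ, ∀ a ∈ component α, ∀ b ∈ component β, ∀ c ∈ component γ,
    (ε.toFun γ α : k) • bracket a (bracket b c)
      + (ε.toFun β γ : k) • bracket c (bracket a b)
      + (ε.toFun α β : k) • bracket b (bracket c a) = 0

namespace ColorLieAlgebra

variable {k Γ : Type*} [Field k] [AddCommGroup Γ] [DecidableEq Γ] {ε : CommutationFactor k Γ}
  {L : Type*} [AddCommGroup L] [Module k L]

/-- A color Lie algebra is abelian if its bracket vanishes. -/
def IsAbelian (g : ColorLieAlgebra ε L) : Prop := ∀ a b, g.bracket a b = 0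

/-- The defining relations `a b - ε(α, β) b a = ⟨a, b⟩` (for homogeneous `a`, `b` of degrees
`α`, `β`) of the universal enveloping algebra, in the tensor algebra of `L`. -/
inductive EnvelopeRel (g : ColorLieAlgebra ε L) : TensorAlgebra k L → TensorAlgebra k L → Prop
  | comm (α β : Γ) (a b : L) (ha : a ∈ g.component α) (hb : b ∈ g.component β) :
      EnvelopeRel g
        (TensorAlgebra.ι k a * TensorAlgebra.ι k b
          - (ε.toFun α β : k) • (TensorAlgebra.ι k b * TensorAlgebra.ι k a))
        (TensorAlgebra.ι k (g.bracket a b))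

/-- The universal enveloping algebra `U(g)`: the tensor algebra modulo the defining relations. -/
abbrev Envelope (g : ColorLieAlgebra ε L) := RingQuot g.EnvelopeRel

/-- The canonical map `g → U(g)`. -/
noncomputable def envelopeι (g : ColorLieAlgebra ε L) : L →ₗ[k] g.Envelope :=
  (RingQuot.mkAlgHom k g.EnvelopeRel).toLinearMap ∘ₗ TensorAlgebra.ι k

/-- The degree `n` component of `U(g)` with respect to word length in the generators `g`:
the span of all products of `n` elements of the image of `g` (for `n = 0`, the span of `1`). -/
noncomputable def envelopeDegree (g : ColorLieAlgebra ε L) (n : ℕ) : Submodule k g.Envelope :=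
  LinearMap.range g.envelopeι ^ n

end ColorLieAlgebra

/-! ### Graded algebras, graded free resolutions of the trivial module, and Koszulity -/

namespace GradedKoszul

open MulOpposite

universe u v w

variable {k : Type u} {R : Type v} [Field k] [Ring R] [Algebra k R]

/-- The subspaces `𝒜 n` make `R` a standard algebra: a `ℕ`-graded algebra with finite-dimensional
components and zero component `k`, generated by its component of degree one and the unit. -/
structure IsStandard (𝒜 : ℕ → Submodule k R) : Prop where
  gradedMonoid : SetLike.GradedMonoid 𝒜
  isInternal : DirectSum.IsInternal 𝒜
  finite : ∀ n, Module.Finite k (𝒜 n)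
  algebraMap_injective : Function.Injective (algebraMap k R)
  zero_eq : 𝒜 0 = LinearMap.range (Algebra.linearMap k R)
  adjoin_one : Algebra.adjoin k (𝒜 1 : Set R) = ⊤

/-- The augmentation ideal `R₊`, generated (as a right ideal) by the components of positive
degree. Right `R`-modules are modules over `Rᵐᵒᵖ`. The trivial right module is `R ⧸ R₊`, which
is `k` if `𝒜` is a connected grading. -/
def augIdeal (𝒜 : ℕ → Submodule k R) : Submodule Rᵐᵒᵖ R :=
  Submodule.span Rᵐᵒᵖ {r : R | ∃ n, 0 < n ∧ r ∈ 𝒜 n}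

/-- The component of degree `j` of the graded free right module `⨁ₓ R(-deg x)`
with a basis of elements `x : X` of degrees `deg x`. -/
def freeDegree (𝒜 : ℕ → Submodule k R) {X : Type w} (deg : X → ℕ) (j : ℕ) :
    Submodule k (X →₀ R) where
  carrier := {f | ∀ x, f x ∈ if deg x ≤ j then 𝒜 (j - deg x) else ⊥}
  add_mem' hf hg x := Submodule.add_mem _ (hf x) (hg x)
  zero_mem' _ := Submodule.zero_mem _
  smul_mem' c _ hf x := Submodule.smul_mem _ c (hf x)

/-- A graded free resolution `⋯ → P₁ → P₀ → k → 0` of the trivial right module `R ⧸ R₊`, with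
`Pᵢ` the graded free right module on generators `gen i` of degrees `deg i` and with differentials
and augmentation of degree zero. -/
structure FreeResolution (𝒜 : ℕ → Submodule k R) where
  gen : ℕ → Type w
  deg : ∀ i, gen i → ℕ
  d : ∀ i, (gen (i + 1) →₀ R) →ₗ[Rᵐᵒᵖ] (gen i →₀ R)
  aug : (gen 0 →₀ R) →ₗ[Rᵐᵒᵖ] (R ⧸ augIdeal 𝒜)
  d_mem : ∀ i j, ∀ f ∈ freeDegree 𝒜 (deg (i + 1)) j, d i f ∈ freeDegree 𝒜 (deg i) j
  aug_mem : ∀ j, ∀ f ∈ freeDegree 𝒜 (deg 0) j, ∃ r ∈ 𝒜 j, aug f = Submodule.Quotient.mk r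
  aug_surjective : Function.Surjective aug
  exact_aug : Function.Exact (d 0) aug
  exact_d : ∀ i, Function.Exact (d (i + 1)) (d i)

/-- The submodule `M R₊` of a right module `M`. -/
def mulAug (𝒜 : ℕ → Submodule k R) (M : Type*) [AddCommGroup M] [Module Rᵐᵒᵖ M] :
    Submodule Rᵐᵒᵖ M :=
  Submodule.span Rᵐᵒᵖ {m : M | ∃ x : M, ∃ r ∈ augIdeal 𝒜, m = op r • x}

theorem mulAug_le_comap (𝒜 : ℕ → Submodule k R) {M N : Type*} [AddCommGroup M] [Module Rᵐᵒᵖ M]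
    [AddCommGroup N] [Module Rᵐᵒᵖ N] (f : M →ₗ[Rᵐᵒᵖ] N) :
    mulAug 𝒜 M ≤ (mulAug 𝒜 N).comap f := by
  refine Submodule.span_le.2 ?_
  rintro _ ⟨x, r, hr, rfl⟩
  exact Submodule.subset_span ⟨f x, r, hr, map_smul f (op r) x⟩

namespace FreeResolution

variable {𝒜 : ℕ → Submodule k R} (P : FreeResolution.{u, v, w} 𝒜)

/-- The vector space `Pᵢ ⊗_R k = Pᵢ / Pᵢ R₊`. -/
abbrev Red (i : ℕ) := (P.gen i →₀ R) ⧸ mulAug 𝒜 (P.gen i →₀ R)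

/-- The differential `Pᵢ₊₁ ⊗_R k → Pᵢ ⊗_R k`. -/
noncomputable def redD (i : ℕ) : P.Red (i + 1) →ₗ[k] P.Red i :=
  (Submodule.mapQ _ _ (P.d i) (mulAug_le_comap 𝒜 (P.d i))).restrictScalars k

/-- The component of degree `j` of `Pᵢ ⊗_R k`. -/
noncomputable def redDegree (i j : ℕ) : Submodule k (P.Red i) :=
  (freeDegree 𝒜 (P.deg i) j).map ((mulAug 𝒜 (P.gen i →₀ R)).mkQ.restrictScalars k)

/-- The cycles of `P ⊗_R k` of homological degree `i` and internal degree `j`. -/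
noncomputable def cycles : (i j : ℕ) → Submodule k (P.Red i)
  | 0, j => P.redDegree 0 j
  | i + 1, j => P.redDegree (i + 1) j ⊓ LinearMap.ker (P.redD i)

/-- The boundaries of `P ⊗_R k` of homological degree `i` and internal degree `j`. -/
noncomputable def boundaries (i j : ℕ) : Submodule k (P.Red i) :=
  (P.redDegree (i + 1) j).map (P.redD i)

/-- `Tor_i^R(k, k)_j`, computed by the graded free resolution `P`: the component of internal
degree `j` of the `i`-th homology of `P ⊗_R k`. -/
abbrev Tor (i j : ℕ) := P.cycles i j ⧸ (P.boundaries i j).submoduleOf (P.cycles i j)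

end FreeResolution

/-- The algebra `R` with the grading `𝒜` is homogeneous Koszul: it is standard, its trivial right
module has a linear free resolution (of finite rank in each homological degree, with
generators of `Pᵢ` in degree `i`), and `H_i R = Tor_i^R(k, k)`, computed by any graded free
resolution, is concentrated in degree `i`. -/
structure IsHomogeneousKoszul (𝒜 : ℕ → Submodule k R) : Prop where
  isStandard : IsStandard 𝒜
  exists_linear : ∃ P : FreeResolution.{u, v, v} 𝒜,
    ∀ i, Finite (P.gen i) ∧ ∀ x : P.gen i, P.deg i x = i
  tor_eq_zero : ∀ P : FreeResolution.{u, v, v} 𝒜, ∀ i j, j ≠ i → Subsingleton (P.Tor i j)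

end GradedKoszul

/-! Choose a homogeneous basis of `g` and put `q i j = ε(deg i, deg j)`. Then `R` is generated by
elements `x i` with `x i * x j = q i j • (x j * x i)` and `q i j * q j i = 1`: a skew polynomial
algebra in the even generators (`q i i = 1`) and a skew exterior one in the odd generators (`q i i ≠
1`, which forces `x i * x i = 0`). Ordered monomials `x^a` with odd exponents at most `1` span `R`.
They are independent because `R` acts on formal monomials and `x^a` sends the formal unit to the
formal monomial `a` (`exists_basis`).

The Koszul complex reverses the parities: its generators `e_b` have even exponents at most `1` and
arbitrary odd exponents, as in divided powers. The differential sends `e_b r` to the sum over `l`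
with `b l ≠ 0` of `e_(b - δ_l) (x_l r)`, weighted by `coeff (negq q) l b`. Let `j` be the first
index in the support of `a + b`. The homotopy sends `e_b x^a` to `e_(b + δ_j) x^(a - δ_j)` if `a j ≠
0`, and to zero otherwise. In positive homological degree `dh + hd = 1` (`koszul_homotopy`), so the
complex is a linear resolution (`exists_linear_resolution`).

Any graded free resolution is homotopy equivalent to this one in degree zero, so its `Tor_i` is
concentrated in degree `i` (`subsingleton_tor`). The grading is internal because the relations of an
abelian `g` are homogeneous (`IsAbelian.isInternal_envelopeDegree`). -/

namespace GradedKoszul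

open MulOpposite

universe u v w

variable {k : Type u} {R : Type v} [Field k] [Ring R] [Algebra k R]

/-! ### Graded free right modules. -/

section Free

variable {𝒜 : ℕ → Submodule k R} {X Y Z : Type*}

/-- The map of right modules out of a free module with prescribed values on the generators. -/
noncomputable def freeLift {N : Type*} [AddCommGroup N] [Module Rᵐᵒᵖ N] (n : X → N) :
    (X →₀ R) →ₗ[Rᵐᵒᵖ] N :=
  Finsupp.lsum ℕ fun x =>
    { toFun := fun r => op r • n x
      map_add' := fun r s => by rw [op_add, add_smul]
      map_smul' := fun c r => by
        rw [smul_eq_mul_unop, op_mul, op_unop, mul_smul, RingHom.id_apply] }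

theorem freeLift_single {N : Type*} [AddCommGroup N] [Module Rᵐᵒᵖ N] (n : X → N) (x : X) (r : R) :
    freeLift n (Finsupp.single x r) = op r • n x := by
  simp [freeLift]

theorem freeLift_apply {N : Type*} [AddCommGroup N] [Module Rᵐᵒᵖ N] (n : X → N) (f : X →₀ R) :
    freeLift n f = ∑ x ∈ f.support, op (f x) • n x := by
  simp [freeLift, Finsupp.sum]

theorem single_eq_op_smul (x : X) (r : R) :
    Finsupp.single x r = op r • Finsupp.single x (1 : R) := by
  simp

theorem hom_ext_single {N : Type*} [AddCommGroup N] [Module Rᵐᵒᵖ N]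
    {f g : (X →₀ R) →ₗ[Rᵐᵒᵖ] N}
    (h : ∀ x, f (Finsupp.single x 1) = g (Finsupp.single x 1)) (z : X →₀ R) : f z = g z := by
  induction z using Finsupp.induction_linear with
  | zero => simp
  | add a b ha hb => rw [map_add, map_add, ha, hb]
  | single x r => rw [single_eq_op_smul, map_smul, map_smul, h]

theorem single_mem_freeDegree {deg : X → ℕ} {j : ℕ} {x : X} {r : R} (hx : deg x ≤ j)
    (hr : r ∈ 𝒜 (j - deg x)) : Finsupp.single x r ∈ freeDegree 𝒜 deg j := by
  classical
  intro y
  by_cases h : x = y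
  · subst h
    rwa [Finsupp.single_eq_same, if_pos hx]
  · rw [Finsupp.single_eq_of_ne' h]
    exact zero_mem _

theorem single_one_mem_freeDegree [SetLike.GradedMonoid 𝒜] (deg : X → ℕ) (x : X) :
    Finsupp.single x (1 : R) ∈ freeDegree 𝒜 deg (deg x) :=
  single_mem_freeDegree le_rfl (by simpa using SetLike.GradedOne.one_mem)

theorem op_smul_mem_freeDegree [SetLike.GradedMonoid 𝒜] {deg : X → ℕ} {i j : ℕ} {f : X →₀ R}
    (hf : f ∈ freeDegree 𝒜 deg i) {r : R} (hr : r ∈ 𝒜 j) :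
    op r • f ∈ freeDegree 𝒜 deg (i + j) := by
  intro x
  have h := hf x
  rw [Finsupp.smul_apply, op_smul_eq_mul]
  by_cases hx : deg x ≤ i
  · rw [if_pos hx] at h
    rw [if_pos (hx.trans (Nat.le_add_right _ _)), Nat.sub_add_comm hx]
    exact SetLike.GradedMul.mul_mem h hr
  · rw [if_neg hx, Submodule.mem_bot] at h
    rw [h, zero_mul]
    exact zero_mem _

theorem freeLift_mem_freeDegree [SetLike.GradedMonoid 𝒜] {deg : X → ℕ} {deg' : Y → ℕ}
    {n : X → Y →₀ R} (hn : ∀ x, n x ∈ freeDegree 𝒜 deg' (deg x)) {j : ℕ} {f : X →₀ R}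
    (hf : f ∈ freeDegree 𝒜 deg j) : freeLift n f ∈ freeDegree 𝒜 deg' j := by
  rw [freeLift_apply]
  refine Submodule.sum_mem _ fun x _ => ?_
  have h := hf x
  by_cases hx : deg x ≤ j
  · rw [if_pos hx] at h
    simpa [Nat.add_sub_cancel' hx] using op_smul_mem_freeDegree (hn x) h
  · rw [if_neg hx, Submodule.mem_bot] at h
    rw [h, op_zero, zero_smul]
    exact zero_mem _

theorem iSup_freeDegree (h𝒜 : DirectSum.IsInternal 𝒜) (deg : X → ℕ) :
    ⨆ j, freeDegree 𝒜 deg j = ⊤ := by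
  refine Submodule.eq_top_iff'.2 fun f => ?_
  induction f using Finsupp.induction_linear with
  | zero => exact zero_mem _
  | add a b ha hb => exact add_mem ha hb
  | single x r =>
    have hr : r ∈ ⨆ n, 𝒜 n := h𝒜.submodule_iSup_eq_top ▸ Submodule.mem_top
    induction hr using Submodule.iSup_induction' with
    | mem n r hr =>
      exact Submodule.mem_iSup_of_mem (n + deg x)
        (single_mem_freeDegree (Nat.le_add_left _ _) (by rwa [Nat.add_sub_cancel]))
    | zero => rw [Finsupp.single_zero]; exact zero_mem _
    | add r s _ _ hr hs => rw [Finsupp.single_add]; exact add_mem hr hs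

/-- Every element of a graded free module splits off its component of degree `j`, compatibly with
maps of degree zero. -/
theorem exists_freeProj (h𝒜 : DirectSum.IsInternal 𝒜) (deg : X → ℕ) (j : ℕ) :
    ∃ π : (X →₀ R) →ₗ[k] (X →₀ R), (∀ f, π f ∈ freeDegree 𝒜 deg j) ∧
      (∀ f ∈ freeDegree 𝒜 deg j, π f = f) ∧
      ∀ i, i ≠ j → ∀ f ∈ freeDegree 𝒜 deg i, π f = 0 := by
  classical
  let _ := h𝒜.chooseDecomposition
  let p : ℕ → R →ₗ[k] R := fun n =>
    (𝒜 n).subtype ∘ₗ DirectSum.component k ℕ _ n ∘ₗ (DirectSum.decomposeLinearEquiv 𝒜).toLinearMap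
  have hp : ∀ n r, p n r = (DirectSum.decompose 𝒜 r n : R) := fun n r => rfl
  let π : (X →₀ R) →ₗ[k] (X →₀ R) := Finsupp.lsum k fun x =>
    Finsupp.lsingle x ∘ₗ (if deg x ≤ j then p (j - deg x) else 0)
  have hπ : ∀ f x, π f x = if deg x ≤ j then p (j - deg x) (f x) else 0 := by
    intro f x
    induction f using Finsupp.induction_linear with
    | zero => simp
    | add a b ha hb =>
      rw [map_add, Finsupp.add_apply, ha, hb, Finsupp.add_apply, map_add]
      split_ifs <;> simp
    | single y r =>
      simp only [π, Finsupp.lsum_single, LinearMap.comp_apply, Finsupp.lsingle_apply,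
        Finsupp.single_apply]
      by_cases h : y = x
      · subst h; simp only [if_true]; split_ifs <;> simp
      · simp [h]
  refine ⟨π, fun f x => ?_, fun f hf => ?_, fun i hi f hf => ?_⟩
  · rw [hπ]
    split_ifs
    · rw [hp]; exact SetLike.coe_mem _
    · exact zero_mem _
  · ext x
    have h := hf x
    rw [hπ]
    split_ifs at h ⊢
    · rw [hp, DirectSum.decompose_of_mem_same _ h]
    · exact ((Submodule.mem_bot k).1 h).symm
  · ext x
    have h := hf x
    rw [hπ, Finsupp.zero_apply]
    split_ifs at h ⊢ with h1 h2
    · rw [hp, DirectSum.decompose_of_mem_ne _ h (by omega)]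
    · rw [(Submodule.mem_bot k).1 h, map_zero]
    · rfl
    · rfl

/-- A map of degree zero commutes with the projections to degree `j`, so any preimage may be
replaced by its component of degree `j`. -/
theorem exists_homogeneous_preimage (h𝒜 : DirectSum.IsInternal 𝒜) {deg : X → ℕ} {deg' : Y → ℕ}
    {δ : (X →₀ R) →ₗ[Rᵐᵒᵖ] (Y →₀ R)}
    (hδ : ∀ j, ∀ f ∈ freeDegree 𝒜 deg j, δ f ∈ freeDegree 𝒜 deg' j) {j : ℕ} {z : Y →₀ R}
    (hz : z ∈ freeDegree 𝒜 deg' j) (hz' : z ∈ LinearMap.range δ) :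
    ∃ w ∈ freeDegree 𝒜 deg j, δ w = z := by
  obtain ⟨π, h1, h2, h3⟩ := exists_freeProj h𝒜 deg j
  obtain ⟨π', -, h2', h3'⟩ := exists_freeProj h𝒜 deg' j
  have hcomm : ∀ f, δ (π f) = π' (δ f) := by
    intro f
    have hf : f ∈ ⨆ i, freeDegree 𝒜 deg i := iSup_freeDegree h𝒜 deg ▸ Submodule.mem_top
    induction hf using Submodule.iSup_induction' with
    | mem i f hf =>
      by_cases hi : i = j
      · subst hi; rw [h2 _ hf, h2' _ (hδ _ _ hf)]
      · rw [h3 i hi _ hf, h3' i hi _ (hδ _ _ hf), map_zero]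
    | zero => simp
    | add a b _ _ ha hb => simp only [map_add, ha, hb]
  obtain ⟨w, rfl⟩ := hz'
  exact ⟨π w, h1 w, by rw [hcomm, h2' _ hz]⟩

/-- Graded free modules are projective among graded free modules and maps of degree zero. -/
theorem exists_graded_lift [SetLike.GradedMonoid 𝒜] (h𝒜 : DirectSum.IsInternal 𝒜)
    {degX : X → ℕ} {degY : Y → ℕ} {degZ : Z → ℕ} {δ : (Y →₀ R) →ₗ[Rᵐᵒᵖ] (Z →₀ R)}
    (hδ : ∀ j, ∀ f ∈ freeDegree 𝒜 degY j, δ f ∈ freeDegree 𝒜 degZ j)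
    {ψ : (X →₀ R) →ₗ[Rᵐᵒᵖ] (Z →₀ R)}
    (hψ : ∀ j, ∀ f ∈ freeDegree 𝒜 degX j, ψ f ∈ freeDegree 𝒜 degZ j)
    (h : ∀ f, ψ f ∈ LinearMap.range δ) :
    ∃ σ : (X →₀ R) →ₗ[Rᵐᵒᵖ] (Y →₀ R),
      (∀ j, ∀ f ∈ freeDegree 𝒜 degX j, σ f ∈ freeDegree 𝒜 degY j) ∧ ∀ f, δ (σ f) = ψ f := by
  choose n hn hn' using fun x : X => exists_homogeneous_preimage h𝒜 hδ
    (hψ _ _ (single_one_mem_freeDegree degX x)) (h _)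
  refine ⟨freeLift n, fun j f hf => freeLift_mem_freeDegree hn hf, fun f => ?_⟩
  refine hom_ext_single (f := δ ∘ₗ freeLift n) (g := ψ) (fun x => ?_) f
  rw [LinearMap.comp_apply, freeLift_single, op_one, one_smul, hn']

theorem mem_augIdeal_of_mem {n : ℕ} (hn : 0 < n) {r : R} (hr : r ∈ 𝒜 n) : r ∈ augIdeal 𝒜 :=
  Submodule.subset_span ⟨n, hn, hr⟩

/-- The coefficients have degree `j - i > 0`, or vanish if `j < i`. This is where linearity of a
resolution enters the computation of Tor. -/
theorem mem_mulAug_of_mem_freeDegree {deg : X → ℕ} {i j : ℕ} (hdeg : ∀ x, deg x = i) (hij : j ≠ i)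
    {f : X →₀ R} (hf : f ∈ freeDegree 𝒜 deg j) : f ∈ mulAug 𝒜 (X →₀ R) := by
  rw [← Finsupp.sum_single f]
  refine Submodule.sum_mem _ fun x _ => ?_
  have h := hf x
  rw [hdeg] at h
  split_ifs at h with hi
  · rw [single_eq_op_smul]
    exact Submodule.subset_span ⟨_, _, mem_augIdeal_of_mem (by omega) h, rfl⟩
  · rw [(Submodule.mem_bot k).1 h, Finsupp.single_zero]
    exact zero_mem _

end Free

/-! ### Comparison of graded free resolutions, and Tor. -/

namespace FreeResolution

variable {𝒜 : ℕ → Submodule k R}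

/-- The quotient `R ⧸ R₊` lives in degree zero: for `j > 0` the class of `r` vanishes, and for `j =
0` the augmentation does not see the other components of a preimage. -/
theorem exists_aug_preimage (h𝒜 : DirectSum.IsInternal 𝒜) (Q : FreeResolution.{u, v, w} 𝒜) {j : ℕ}
    {r : R} (hr : r ∈ 𝒜 j) :
    ∃ q ∈ freeDegree 𝒜 (Q.deg 0) j, Q.aug q = Submodule.Quotient.mk r := by
  have hpos : ∀ n, n ≠ 0 → ∀ s ∈ 𝒜 n, (Submodule.Quotient.mk s : R ⧸ augIdeal 𝒜) = 0 :=
    fun n hn s hs => (Submodule.Quotient.mk_eq_zero _).2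
      (mem_augIdeal_of_mem (Nat.pos_of_ne_zero hn) hs)
  by_cases hj : j = 0
  · subst hj
    obtain ⟨π, h1, h2, h3⟩ := exists_freeProj h𝒜 (Q.deg 0) 0
    have hπ : ∀ f, Q.aug (π f) = Q.aug f := by
      intro f
      have hf : f ∈ ⨆ i, freeDegree 𝒜 (Q.deg 0) i := iSup_freeDegree h𝒜 (Q.deg 0) ▸ Submodule.mem_top
      induction hf using Submodule.iSup_induction' with
      | mem i f hf =>
        by_cases hi : i = 0
        · subst hi; rw [h2 _ hf]
        · obtain ⟨s, hs, hs'⟩ := Q.aug_mem i f hf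
          rw [h3 i hi _ hf, hs', hpos i hi s hs, map_zero]
      | zero => simp
      | add a b _ _ ha hb => simp only [map_add, ha, hb]
    obtain ⟨q, hq⟩ := Q.aug_surjective (Submodule.Quotient.mk r)
    exact ⟨π q, h1 q, by rw [hπ, hq]⟩
  · exact ⟨0, zero_mem _, by rw [map_zero, hpos j hj r hr]⟩

/-- The comparison theorem: a chain map of degree zero over the identity. -/
theorem exists_chainMap [SetLike.GradedMonoid 𝒜] (h𝒜 : DirectSum.IsInternal 𝒜)
    (P Q : FreeResolution.{u, v, w} 𝒜) :
    ∃ f : ∀ i, (P.gen i →₀ R) →ₗ[Rᵐᵒᵖ] (Q.gen i →₀ R),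
      (∀ i j, ∀ z ∈ freeDegree 𝒜 (P.deg i) j, f i z ∈ freeDegree 𝒜 (Q.deg i) j) ∧
      (∀ z, Q.aug (f 0 z) = P.aug z) ∧ ∀ i z, Q.d i (f (i + 1) z) = f i (P.d i z) := by
  obtain ⟨f₀, hf₀, hf₀'⟩ : ∃ f : (P.gen 0 →₀ R) →ₗ[Rᵐᵒᵖ] (Q.gen 0 →₀ R),
      (∀ j, ∀ z ∈ freeDegree 𝒜 (P.deg 0) j, f z ∈ freeDegree 𝒜 (Q.deg 0) j) ∧
      ∀ z, Q.aug (f z) = P.aug z := by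
    choose r hr hr' using fun x => P.aug_mem _ _ (single_one_mem_freeDegree (P.deg 0) x)
    choose q hq hq' using fun x => exists_aug_preimage h𝒜 Q (hr x)
    refine ⟨freeLift q, fun j z hz => freeLift_mem_freeDegree hq hz, fun z => ?_⟩
    refine hom_ext_single (f := Q.aug ∘ₗ freeLift q) (g := P.aug) (fun x => ?_) z
    rw [LinearMap.comp_apply, freeLift_single, op_one, one_smul, hq', hr']
  -- The recursion carries along the range condition, which is exactly what the next lift through
  -- `Q.d i` requires.
  let S : ℕ → Type _ := fun i => {f : (P.gen i →₀ R) →ₗ[Rᵐᵒᵖ] (Q.gen i →₀ R) //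
    (∀ j, ∀ z ∈ freeDegree 𝒜 (P.deg i) j, f z ∈ freeDegree 𝒜 (Q.deg i) j) ∧
    ∀ z, f (P.d i z) ∈ LinearMap.range (Q.d i)}
  have step : ∀ i (f : S i), ∃ f' : S (i + 1), ∀ z, Q.d i (f'.1 z) = f.1 (P.d i z) := by
    rintro i ⟨f, hf, hf'⟩
    obtain ⟨σ, hσ, hσ'⟩ := exists_graded_lift h𝒜 (Q.d_mem i) (ψ := f ∘ₗ P.d i)
      (fun j z hz => hf j _ (P.d_mem i j z hz)) hf'
    refine ⟨⟨σ, hσ, fun z => (Q.exact_d i _).1 ?_⟩, hσ'⟩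
    rw [hσ', LinearMap.comp_apply, (P.exact_d i).apply_apply_eq_zero, map_zero]
  choose next hnext using step
  let F : ∀ i, S i := fun i => Nat.rec
    ⟨f₀, hf₀, fun z => (Q.exact_aug _).1 (by rw [hf₀', P.exact_aug.apply_apply_eq_zero])⟩ next i
  exact ⟨fun i => (F i).1, fun i => (F i).2.1, hf₀', fun i => hnext i (F i)⟩

/-- A chain endomorphism of degree zero over the zero map is null homotopic. -/
theorem exists_homotopy [SetLike.GradedMonoid 𝒜] (h𝒜 : DirectSum.IsInternal 𝒜)
    (P : FreeResolution.{u, v, w} 𝒜) (φ : ∀ i, (P.gen i →₀ R) →ₗ[Rᵐᵒᵖ] (P.gen i →₀ R))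
    (hφ : ∀ i j, ∀ z ∈ freeDegree 𝒜 (P.deg i) j, φ i z ∈ freeDegree 𝒜 (P.deg i) j)
    (hφ₀ : ∀ z, P.aug (φ 0 z) = 0) (hφd : ∀ i z, P.d i (φ (i + 1) z) = φ i (P.d i z)) :
    ∃ s : ∀ i, (P.gen i →₀ R) →ₗ[Rᵐᵒᵖ] (P.gen (i + 1) →₀ R),
      (∀ i j, ∀ z ∈ freeDegree 𝒜 (P.deg i) j, s i z ∈ freeDegree 𝒜 (P.deg (i + 1)) j) ∧
      (∀ z, P.d 0 (s 0 z) = φ 0 z) ∧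
      ∀ i z, P.d (i + 1) (s (i + 1) z) = φ (i + 1) z - s i (P.d i z) := by
  obtain ⟨s₀, hs₀, hs₀'⟩ := exists_graded_lift h𝒜 (P.d_mem 0) (hφ 0)
    (fun z => (P.exact_aug _).1 (hφ₀ z))
  -- The invariant `d s d = φ d` makes `φ (i + 1) - s d` take values in cycles, hence in boundaries.
  let S : ℕ → Type _ := fun i => {s : (P.gen i →₀ R) →ₗ[Rᵐᵒᵖ] (P.gen (i + 1) →₀ R) //
    (∀ j, ∀ z ∈ freeDegree 𝒜 (P.deg i) j, s z ∈ freeDegree 𝒜 (P.deg (i + 1)) j) ∧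
    ∀ z, P.d i (s (P.d i z)) = φ i (P.d i z)}
  have step : ∀ i (s : S i), ∃ s' : S (i + 1),
      ∀ z, P.d (i + 1) (s'.1 z) = φ (i + 1) z - s.1 (P.d i z) := by
    rintro i ⟨s, hs, hs'⟩
    obtain ⟨σ, hσ, hσ'⟩ := exists_graded_lift h𝒜 (P.d_mem (i + 1)) (ψ := φ (i + 1) - s ∘ₗ P.d i)
      (fun j z hz => Submodule.sub_mem _ (hφ _ j _ hz) (hs j _ (P.d_mem i j z hz)))
      (fun z => (P.exact_d i _).1 (by
        rw [LinearMap.sub_apply, map_sub, LinearMap.comp_apply, hs', hφd, sub_self]))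
    refine ⟨⟨σ, hσ, fun z => ?_⟩, hσ'⟩
    rw [hσ', LinearMap.sub_apply, LinearMap.comp_apply, (P.exact_d i).apply_apply_eq_zero, map_zero,
      sub_zero]
  choose next hnext using step
  let F : ∀ i, S i := fun i => Nat.rec ⟨s₀, hs₀, fun z => hs₀' _⟩ next i
  exact ⟨fun i => (F i).1, fun i => (F i).2.1, hs₀', fun i => hnext i (F i)⟩

/-- If the trivial module has a linear free resolution, then `Tor_i(k, k)`, computed by any graded
free resolution, is concentrated in degree `i`. -/
theorem subsingleton_tor [SetLike.GradedMonoid 𝒜] (h𝒜 : DirectSum.IsInternal 𝒜)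
    (P Q : FreeResolution.{u, v, w} 𝒜) (hQ : ∀ i x, Q.deg i x = i) {i j : ℕ} (hij : j ≠ i) :
    Subsingleton (P.Tor i j) := by
  obtain ⟨f, hf, hf₀, hfd⟩ := exists_chainMap h𝒜 P Q
  obtain ⟨g, hg, hg₀, hgd⟩ := exists_chainMap h𝒜 Q P
  obtain ⟨s, hs, hs₀, hsd⟩ := exists_homotopy h𝒜 P (fun i => g i ∘ₗ f i - LinearMap.id)
    (fun i j z hz => Submodule.sub_mem _ (hg i j _ (hf i j z hz)) hz)
    (fun z => by simp [hg₀, hf₀])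
    (fun i z => by simp [hgd, hfd])
  -- Modulo `P R₊` the term `g (f z)` vanishes, as `f z` lies in degree `j ≠ i` of the linear `Q i`;
  -- so `z` becomes the boundary of `-s z`. The error `t` is `s (d z)` for `i > 0`, negligible
  -- because `z` is a cycle modulo `P R₊`.
  have key : ∀ z ∈ freeDegree 𝒜 (P.deg i) j, ∀ t ∈ mulAug 𝒜 (P.gen i →₀ R),
      P.d i (s i z) = g i (f i z) - z - t →
      (mulAug 𝒜 (P.gen i →₀ R)).mkQ z ∈ P.boundaries i j := by
    intro z hz t ht h
    refine ⟨(mulAug 𝒜 _).mkQ (-(s i z)), ⟨_, Submodule.neg_mem _ (hs i j z hz), rfl⟩, ?_⟩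
    have h1 : P.redD i ((mulAug 𝒜 _).mkQ (-(s i z))) = (mulAug 𝒜 _).mkQ (P.d i (-(s i z))) := rfl
    rw [h1, Submodule.mkQ_apply, Submodule.mkQ_apply, Submodule.Quotient.eq, map_neg, h]
    have h2 : -(g i (f i z) - z - t) - z = t - g i (f i z) := by abel
    rw [h2]
    exact Submodule.sub_mem _ ht
      (mulAug_le_comap 𝒜 (g i) (mem_mulAug_of_mem_freeDegree (hQ i) hij (hf i j z hz)))
  have hle : P.cycles i j ≤ P.boundaries i j := by
    cases i with
    | zero =>
      rintro _ ⟨z, hz, rfl⟩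
      exact key z hz 0 (zero_mem _) (by simp [hs₀])
    | succ i =>
      rintro _ ⟨⟨z, hz, rfl⟩, hz'⟩
      have h0 : (mulAug 𝒜 _).mkQ (P.d i z) = 0 := hz'
      rw [Submodule.mkQ_apply, Submodule.Quotient.mk_eq_zero] at h0
      exact key z hz (s i (P.d i z)) (mulAug_le_comap 𝒜 (s i) h0) (by simp [hsd])
  rw [Submodule.Quotient.subsingleton_iff, Submodule.submoduleOf_eq_top]
  exact hle

end FreeResolution

end GradedKoszul

/-! ### Universal property and grading of the enveloping algebra. -/

namespace ColorLieAlgebra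

open scoped DirectSum

variable {k Γ : Type*} [Field k] [AddCommGroup Γ] [DecidableEq Γ] {ε : CommutationFactor k Γ}
  {L : Type*} [AddCommGroup L] [Module k L] (g : ColorLieAlgebra ε L)

theorem envelopeι_apply (a : L) :
    g.envelopeι a = RingQuot.mkAlgHom k g.EnvelopeRel (TensorAlgebra.ι k a) := rfl

variable {g}

theorem IsAbelian.envelopeι_mul_comm (hg : g.IsAbelian) {α β : Γ} {a b : L}
    (ha : a ∈ g.component α) (hb : b ∈ g.component β) :
    g.envelopeι a * g.envelopeι b = (ε.toFun α β : k) • (g.envelopeι b * g.envelopeι a) := by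
  have h := RingQuot.mkAlgHom_rel k (EnvelopeRel.comm (g := g) α β a b ha hb)
  rw [hg, map_zero, map_zero, map_sub, map_smul, map_mul, map_mul, sub_eq_zero] at h
  exact h

/-- The universal property of the enveloping algebra of an abelian color Lie algebra. -/
noncomputable def IsAbelian.envelopeLift (hg : g.IsAbelian) {A : Type*} [Semiring A] [Algebra k A]
    (f : L →ₗ[k] A)
    (hf : ∀ α β, ∀ a ∈ g.component α, ∀ b ∈ g.component β,
      f a * f b = (ε.toFun α β : k) • (f b * f a)) : g.Envelope →ₐ[k] A :=
  RingQuot.liftAlgHom k ⟨TensorAlgebra.lift k f, by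
    rintro _ _ ⟨α, β, a, b, ha, hb⟩
    rw [hg, map_zero, map_zero, sub_eq_add_neg, ← neg_smul, map_add, map_smul, map_mul, map_mul,
      TensorAlgebra.lift_ι_apply, TensorAlgebra.lift_ι_apply, hf α β a ha b hb, ← add_smul,
      add_neg_cancel, zero_smul]⟩

theorem IsAbelian.envelopeLift_ι (hg : g.IsAbelian) {A : Type*} [Semiring A] [Algebra k A]
    (f : L →ₗ[k] A)
    (hf : ∀ α β, ∀ a ∈ g.component α, ∀ b ∈ g.component β,
      f a * f b = (ε.toFun α β : k) • (f b * f a)) (a : L) :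
    hg.envelopeLift f hf (g.envelopeι a) = f a := by
  rw [envelopeLift, envelopeι_apply, RingQuot.liftAlgHom_mkAlgHom_apply, TensorAlgebra.lift_ι_apply]

variable (g)

theorem adjoin_range_envelopeι : Algebra.adjoin k (Set.range g.envelopeι) = ⊤ := by
  have h : Set.range g.envelopeι
      = RingQuot.mkAlgHom k g.EnvelopeRel '' Set.range (TensorAlgebra.ι k : L →ₗ[k] _) := by
    rw [← Set.range_comp]; rfl
  rw [h, ← AlgHom.map_adjoin, TensorAlgebra.adjoin_range_ι, Algebra.map_top]
  exact (AlgHom.range_eq_top _).2 (RingQuot.mkAlgHom_surjective k _)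

theorem envelope_algHom_ext {A : Type*} [Semiring A] [Algebra k A] {f₁ f₂ : g.Envelope →ₐ[k] A}
    (h : ∀ a, f₁ (g.envelopeι a) = f₂ (g.envelopeι a)) : f₁ = f₂ := by
  refine AlgHom.ext_of_adjoin_eq_top g.adjoin_range_envelopeι ?_
  rintro _ ⟨a, rfl⟩
  exact h a

instance envelopeDegree_gradedMonoid : SetLike.GradedMonoid g.envelopeDegree where
  one_mem := by rw [envelopeDegree, pow_zero]; exact Submodule.one_le.1 le_rfl
  mul_mem i j a b ha hb := by
    rw [envelopeDegree, pow_add]; exact Submodule.mul_mem_mul ha hb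

theorem envelopeι_mem_envelopeDegree (a : L) : g.envelopeι a ∈ g.envelopeDegree 1 := by
  rw [envelopeDegree, pow_one]; exact LinearMap.mem_range_self _ a

/-- The canonical map into the direct sum of the components of the enveloping algebra. -/
noncomputable def gradedι : L →ₗ[k] ⨁ n, g.envelopeDegree n :=
  DirectSum.lof k ℕ (fun n => g.envelopeDegree n) 1 ∘ₗ
    g.envelopeι.codRestrict _ g.envelopeι_mem_envelopeDegree

theorem gradedι_apply (a : L) : g.gradedι a = DirectSum.of (fun n => g.envelopeDegree n) 1
    ⟨g.envelopeι a, g.envelopeι_mem_envelopeDegree a⟩ := rfl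

variable {g}

theorem IsAbelian.gradedι_mul_comm (hg : g.IsAbelian) (α β : Γ) (a : L) (ha : a ∈ g.component α)
    (b : L) (hb : b ∈ g.component β) :
    g.gradedι a * g.gradedι b = (ε.toFun α β : k) • (g.gradedι b * g.gradedι a) := by
  rw [gradedι_apply, gradedι_apply, DirectSum.of_mul_of, DirectSum.of_mul_of,
    ← DirectSum.lof_eq_of k, ← DirectSum.lof_eq_of k, ← map_smul]
  exact congrArg _ (Subtype.ext (hg.envelopeι_mul_comm ha hb))

/-- The defining relations also hold in the external direct sum of the components, so the universal
property yields an algebra map into it; this map is inverse to the summation map. -/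
theorem IsAbelian.isInternal_envelopeDegree (hg : g.IsAbelian) :
    DirectSum.IsInternal g.envelopeDegree := by
  let f := hg.envelopeLift (A := ⨁ n, g.envelopeDegree n) g.gradedι hg.gradedι_mul_comm
  have hf : ∀ a, f (g.envelopeι a) = g.gradedι a := hg.envelopeLift_ι _ _
  let G : GradedAlgebra g.envelopeDegree := GradedAlgebra.ofAlgHom _ f
    (by
      refine g.envelope_algHom_ext fun a => ?_
      rw [AlgHom.comp_apply, hf, gradedι_apply, DirectSum.coeAlgHom_of, AlgHom.id_apply])
    (by
      rintro i ⟨x, hx⟩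
      dsimp only [Subtype.coe_mk]
      induction hx using Submodule.pow_induction_on_left' with
      | algebraMap r => rw [AlgHom.commutes, DirectSum.algebraMap_apply]; rfl
      | add x y i hx hy ihx ihy =>
        rw [map_add, ihx, ihy, ← map_add]
        rfl
      | mem_mul m hm i x hx ih =>
        obtain ⟨a, rfl⟩ := hm
        rw [map_mul, ih, hf, gradedι_apply, DirectSum.of_mul_of]
        exact DirectSum.of_eq_of_gradedMonoid_eq (Sigma.subtype_ext (add_comm _ _) rfl))
  exact DirectSum.Decomposition.isInternal _

/-- The augmentation of the enveloping algebra of an abelian color Lie algebra. -/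
noncomputable def IsAbelian.envelopeCounit (hg : g.IsAbelian) : g.Envelope →ₐ[k] k :=
  hg.envelopeLift 0 (by simp)

theorem IsAbelian.isStandard_envelopeDegree [FiniteDimensional k L] (hg : g.IsAbelian) :
    GradedKoszul.IsStandard g.envelopeDegree where
  gradedMonoid := inferInstance
  isInternal := hg.isInternal_envelopeDegree
  finite n := by
    rw [Module.Finite.iff_fg, envelopeDegree, LinearMap.range_eq_map]
    exact (Module.Finite.fg_top.map g.envelopeι).pow n
  algebraMap_injective := by
    refine Function.LeftInverse.injective (g := hg.envelopeCounit) fun c => ?_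
    rw [AlgHom.commutes]; rfl
  zero_eq := by rw [envelopeDegree, pow_zero, Submodule.one_eq_range]
  adjoin_one := by
    rw [envelopeDegree, pow_one, LinearMap.coe_range, adjoin_range_envelopeι]

/-- A finite-dimensional graded vector space has a finite homogeneous basis. -/
theorem exists_homogeneous_basis [FiniteDimensional k L] (g : ColorLieAlgebra ε L) :
    ∃ (n : ℕ) (x : Module.Basis (Fin n) k L) (deg : Fin n → Γ), (∀ i, x i ∈ g.component (deg i)) ∧
      ∀ α, ∀ a ∈ g.component α, ∀ i, x.repr a i ≠ 0 → deg i = α := by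
  let v : ∀ γ, Module.Basis _ k (g.component γ) := fun γ => Module.Basis.ofVectorSpace k _
  let B := g.isInternal.collectedBasis v
  have : Finite (Σ γ, Module.Basis.ofVectorSpaceIndex k (g.component γ)) :=
    Module.Finite.finite_basis B
  obtain ⟨n, ⟨e⟩⟩ := Finite.exists_equiv_fin (Σ γ, Module.Basis.ofVectorSpaceIndex k (g.component γ))
  refine ⟨n, B.reindex e, fun i => (e.symm i).1, fun i => ?_, fun α a ha i hi => ?_⟩
  · rw [Module.Basis.reindex_apply]
    exact g.isInternal.collectedBasis_mem v _
  · by_contra h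
    refine hi ?_
    rw [Module.Basis.repr_reindex_apply]
    exact g.isInternal.collectedBasis_repr_of_mem_ne v (Ne.symm h) ha

end ColorLieAlgebra

/-! ### Ordered monomials in skew commuting generators. -/

namespace SkewCommutative

variable {k R : Type*} [Field k] [Ring R] [Algebra k R] {n : ℕ}

/-- The product of the scalars `p l t ^ a t` over all `t < l`. -/
def coeff (p : Fin n → Fin n → k) (l : Fin n) (a : Fin n → ℕ) : k :=
  ∏ t, if t < l then p l t ^ a t else 1

theorem coeff_add_single (p : Fin n → Fin n → k) (l t : Fin n) (a : Fin n → ℕ) :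
    coeff p l (a + Pi.single t 1) = coeff p l a * if t < l then p l t else 1 := by
  have h : ∀ s, (if s < l then p l s ^ (a + Pi.single t 1 : Fin n → ℕ) s else 1) =
      (if s < l then p l s ^ a s else 1) * if s = t then (if t < l then p l t else 1) else 1 := by
    intro s
    by_cases hs : s = t
    · subst hs
      by_cases hl : s < l <;> simp [hl, pow_succ]
    · simp [hs]
  simp only [coeff, h, Finset.prod_mul_distrib, Finset.prod_ite_eq', Finset.mem_univ, if_true]

theorem coeff_eq_one (p : Fin n → Fin n → k) {l : Fin n} {a : Fin n → ℕ}
    (h : ∀ t, t < l → a t = 0) : coeff p l a = 1 := by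
  refine Finset.prod_eq_one fun t _ => ?_
  split_ifs with ht
  · rw [h t ht, pow_zero]
  · rfl

theorem coeff_ne_zero {p : Fin n → Fin n → k} (hp : ∀ i j, p i j ≠ 0) (l : Fin n) (a : Fin n → ℕ) :
    coeff p l a ≠ 0 := by
  refine Finset.prod_ne_zero_iff.2 fun t _ => ?_
  split_ifs
  · exact pow_ne_zero _ (hp _ _)
  · exact one_ne_zero

/-- The ordered monomial with exponents `a`. -/
def mono (x : Fin n → R) (a : Fin n → ℕ) : R :=
  ((List.finRange n).map fun i => x i ^ a i).prod

theorem mono_zero (x : Fin n → R) : mono x 0 = 1 := by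
  simp [mono]

/-- The exponents `a` such that the exponents of the odd generators (those with `q i i ≠ 1`) are
at most `1`. -/
def Adm (q : Fin n → Fin n → k) (a : Fin n → ℕ) : Prop := ∀ i, q i i ≠ 1 → a i ≤ 1

theorem Adm.mono {q : Fin n → Fin n → k} {a b : Fin n → ℕ} (h : Adm q b) (hab : a ≤ b) : Adm q a :=
  fun i hi => (hab i).trans (h i hi)

theorem exists_eq_add_single {a : Fin n → ℕ} {l : Fin n} (h : a l ≠ 0) :
    ∃ c : Fin n → ℕ, a = c + Pi.single l 1 := by
  refine ⟨a - Pi.single l 1, (tsub_add_cancel_of_le fun t => ?_).symm⟩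
  by_cases ht : t = l
  · subst ht; simpa using Nat.one_le_iff_ne_zero.2 h
  · simp [ht]

section Relations

variable {q : Fin n → Fin n → k} {x : Fin n → R} (hx : ∀ i j, x i * x j = q i j • (x j * x i))
include hx

theorem mul_self_eq_zero {i : Fin n} (hi : q i i ≠ 1) : x i * x i = 0 := by
  have h : (1 - q i i) • (x i * x i) = 0 := by
    rw [sub_smul, one_smul, ← hx, sub_self]
  exact (smul_eq_zero.1 h).resolve_left (sub_ne_zero.2 (Ne.symm hi))

theorem mono_eq_zero {a : Fin n → ℕ} (ha : ¬ Adm q a) : mono x a = 0 := by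
  simp only [Adm, not_forall, not_le] at ha
  obtain ⟨i, hi, h⟩ := ha
  refine List.prod_eq_zero (List.mem_map.2 ⟨i, List.mem_finRange i, ?_⟩)
  rw [← Nat.add_sub_cancel' (Nat.succ_le_of_lt h), pow_add, pow_two, mul_self_eq_zero hx hi,
    zero_mul]

theorem mul_pow_comm (i j : Fin n) (m : ℕ) : x i * x j ^ m = q i j ^ m • (x j ^ m * x i) := by
  induction m with
  | zero => simp
  | succ m ih =>
    rw [pow_succ, ← mul_assoc, ih, smul_mul_assoc, mul_assoc, hx i j, mul_smul_comm, smul_smul,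
      ← mul_assoc, pow_succ]

/-- Moving right, `x l` passes the powers of `x t` with `t < l`, collecting `q l t ^ a t`, and stops
at its own power. Arbitrary sorted lists make the induction possible. -/
theorem mul_list_prod (l : Fin n) (a : Fin n → ℕ) (S : List (Fin n)) (hS : S.Pairwise (· < ·))
    (hl : l ∈ S) :
    x l * (S.map fun i => x i ^ a i).prod = (S.map fun t => if t < l then q l t ^ a t else 1).prod •
      (S.map fun i => x i ^ (a + Pi.single l 1 : Fin n → ℕ) i).prod := by
  induction S with
  | nil => simp at hl
  | cons i S ih =>
    rw [List.pairwise_cons] at hS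
    rw [List.map_cons, List.map_cons, List.map_cons, List.prod_cons, List.prod_cons, List.prod_cons]
    by_cases h : l = i
    · subst h
      have h1 : (S.map fun t => if t < l then q l t ^ a t else 1).prod = 1 := by
        refine List.prod_eq_one fun y hy => ?_
        obtain ⟨t, ht, rfl⟩ := List.mem_map.1 hy
        rw [if_neg (hS.1 t ht).not_gt]
      have h2 : (S.map fun i => x i ^ (a + Pi.single l 1 : Fin n → ℕ) i) = S.map fun i => x i ^ a i := by
        refine List.map_congr_left fun t ht => ?_
        simp [(hS.1 t ht).ne']
      rw [h1, h2, if_neg (lt_irrefl l), mul_one, one_smul, ← mul_assoc]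
      simp [pow_succ']
    · have hl' : l ∈ S := (List.mem_cons.1 hl).resolve_left h
      rw [← mul_assoc, mul_pow_comm hx, smul_mul_assoc, mul_assoc, ih hS.2 hl', mul_smul_comm,
        smul_smul, if_pos (hS.1 l hl')]
      simp [Ne.symm h]

theorem mul_mono (l : Fin n) (a : Fin n → ℕ) :
    x l * mono x a = coeff q l a • mono x (a + Pi.single l 1) := by
  rw [mono, mul_list_prod hx l a _ (List.pairwise_lt_finRange n) (List.mem_finRange l), coeff,
    Fin.prod_univ_def, mono]

/-- By `mul_mono` the span is a left ideal, and it contains `1`. -/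
theorem span_mono (hgen : Algebra.adjoin k (Set.range x) = ⊤) :
    Submodule.span k (Set.range (mono x)) = ⊤ := by
  set S := Submodule.span k (Set.range (mono x))
  have hmul : ∀ r s, s ∈ S → r * s ∈ S := by
    intro r s hs
    have hr : r ∈ Algebra.adjoin k (Set.range x) := hgen ▸ Algebra.mem_top
    induction hr using Algebra.adjoin_induction generalizing s with
    | mem r hr =>
      obtain ⟨l, rfl⟩ := hr
      induction hs using Submodule.span_induction with
      | mem s hs =>
        obtain ⟨a, rfl⟩ := hs
        rw [mul_mono hx]
        exact Submodule.smul_mem _ _ (Submodule.subset_span ⟨_, rfl⟩)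
      | zero => rw [mul_zero]; exact zero_mem _
      | add s t _ _ hs ht => rw [mul_add]; exact add_mem hs ht
      | smul c s _ hs => rw [mul_smul_comm]; exact Submodule.smul_mem _ _ hs
    | algebraMap c => rw [← Algebra.smul_def]; exact Submodule.smul_mem _ _ hs
    | add r t _ _ hr ht => rw [add_mul]; exact add_mem (hr s hs) (ht s hs)
    | mul r t _ _ hr ht => rw [mul_assoc]; exact hr _ (ht s hs)
  refine Submodule.eq_top_iff'.2 fun r => ?_
  rw [← mul_one r]
  exact hmul r 1 (Submodule.subset_span ⟨0, mono_zero x⟩)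

end Relations

open Classical in
/-- Left multiplication by the `l`-th generator on formal ordered monomials. -/
noncomputable def regularRep (q : Fin n → Fin n → k) (l : Fin n) :
    Module.End k ((Fin n → ℕ) →₀ k) :=
  Finsupp.linearCombination k fun a =>
    if Adm q (a + Pi.single l 1) then Finsupp.single (a + Pi.single l 1) (coeff q l a) else 0

theorem regularRep_single_of_adm {q : Fin n → Fin n → k} {l : Fin n} {a : Fin n → ℕ}
    (h : Adm q (a + Pi.single l 1)) (c : k) :
    regularRep q l (Finsupp.single a c) = Finsupp.single (a + Pi.single l 1) (c * coeff q l a) := by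
  simp [regularRep, h]

theorem regularRep_single_of_not_adm {q : Fin n → Fin n → k} {l : Fin n} {a : Fin n → ℕ}
    (h : ¬ Adm q (a + Pi.single l 1)) (c : k) :
    regularRep q l (Finsupp.single a c) = 0 := by
  simp [regularRep, h]

/-- Only the larger of the two indices picks up a factor from the smaller: `q j i` on the right if
`i < j`, `q i j` on the left if `j < i`. -/
theorem coeff_mul_coeff {q : Fin n → Fin n → k} (hq : ∀ i j, q i j * q j i = 1) {i j : Fin n}
    (hij : i ≠ j) (a : Fin n → ℕ) :
    coeff q j a * coeff q i (a + Pi.single j 1) =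
      q i j * (coeff q i a * coeff q j (a + Pi.single i 1)) := by
  rw [coeff_add_single, coeff_add_single]
  rcases lt_or_gt_of_ne hij with h | h
  · rw [if_neg h.not_gt, if_pos h]
    linear_combination (-(coeff q i a * coeff q j a)) * hq i j
  · rw [if_neg h.not_gt, if_pos h]
    ring

theorem regularRep_mul_comm {q : Fin n → Fin n → k} (hq : ∀ i j, q i j * q j i = 1) (i j : Fin n) :
    regularRep q i * regularRep q j = q i j • (regularRep q j * regularRep q i) := by
  refine Finsupp.lhom_ext fun a c => ?_
  rw [Module.End.mul_apply, LinearMap.smul_apply, Module.End.mul_apply]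
  have hle : ∀ i j : Fin n, a + Pi.single i 1 ≤ a + Pi.single j 1 + Pi.single i 1 := fun i j =>
    add_le_add_left (le_self_add) _
  have hcomm : a + Pi.single i 1 + Pi.single j 1 = a + Pi.single j 1 + Pi.single i 1 :=
    add_right_comm _ _ _
  by_cases h : Adm q (a + Pi.single j 1 + Pi.single i 1)
  · have h' : Adm q (a + Pi.single i 1 + Pi.single j 1) := by rwa [hcomm]
    rw [regularRep_single_of_adm (h.mono le_self_add), regularRep_single_of_adm h,
      regularRep_single_of_adm (h.mono (hle i j)), regularRep_single_of_adm h', hcomm,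
      Finsupp.smul_single, smul_eq_mul]
    congr 1
    by_cases hij : i = j
    · subst hij
      -- Here the exponent of `i` is at least `2`, so admissibility excludes an odd `i`.
      have : q i i = 1 := by
        by_contra hi
        have := h i hi
        simp at this
      rw [this, one_mul]
    · linear_combination c * coeff_mul_coeff hq hij a
  · have key : ∀ i j : Fin n, ¬ Adm q (a + Pi.single j 1 + Pi.single i 1) →
        regularRep q i (regularRep q j (Finsupp.single a c)) = 0 := by
      intro i j h
      by_cases h' : Adm q (a + Pi.single j 1)
      · rw [regularRep_single_of_adm h', regularRep_single_of_not_adm h]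
      · rw [regularRep_single_of_not_adm h', map_zero]
    rw [key i j h, key j i (by rwa [hcomm]), smul_zero]

/-- Given the regular representation, the admissible ordered monomials form a basis. -/
theorem exists_basis {q : Fin n → Fin n → k} (hq : ∀ i j, q i j * q j i = 1) {x : Fin n → R}
    (hx : ∀ i j, x i * x j = q i j • (x j * x i)) (hgen : Algebra.adjoin k (Set.range x) = ⊤)
    (ρ : R →ₐ[k] Module.End k ((Fin n → ℕ) →₀ k)) (hρ : ∀ l, ρ (x l) = regularRep q l) :
    ∃ B : Module.Basis {a : Fin n → ℕ // Adm q a} k R, ∀ a, B a = mono x a.1 := by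
  have hq0 : ∀ i j, q i j ≠ 0 := fun i j h => by simpa [h] using hq i j
  -- Split off any `l` with `a l ≠ 0`. Both `mul_mono` and `regularRep` produce the scalar `coeff q
  -- l c`, which is invertible and cancels.
  have key : ∀ m (a : Fin n → ℕ), ∑ i, a i = m → Adm q a →
      ρ (mono x a) (Finsupp.single 0 1) = Finsupp.single a 1 := by
    intro m
    induction m with
    | zero =>
      intro a ha _
      have : a = 0 := by
        ext i
        exact (Finset.sum_eq_zero_iff.1 ha) i (Finset.mem_univ i)
      rw [this, mono_zero, map_one, Module.End.one_apply]
    | succ m ih =>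
      intro a ha h
      obtain ⟨l, -, hl⟩ := Finset.exists_ne_zero_of_sum_ne_zero (ha.trans_ne m.succ_ne_zero)
      obtain ⟨c, rfl⟩ := exists_eq_add_single hl
      have hc : ∑ i, c i = m := by simpa [Finset.sum_add_distrib] using ha
      have h1 := congrArg ρ (mul_mono hx l c)
      rw [map_mul, map_smul, hρ] at h1
      have h2 := congrArg (fun φ => φ (Finsupp.single 0 1)) h1
      simp only [Module.End.mul_apply, LinearMap.smul_apply] at h2
      rw [ih c hc (h.mono le_self_add), regularRep_single_of_adm h, one_mul] at h2
      have h3 := coeff_ne_zero hq0 l c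
      rw [← inv_smul_smul₀ h3 ((ρ (mono x (c + Pi.single l 1))) (Finsupp.single 0 1)), ← h2,
        Finsupp.smul_single, smul_eq_mul, inv_mul_cancel₀ h3]
  have hli : LinearIndependent k fun a : {a : Fin n → ℕ // Adm q a} => mono x a.1 := by
    refine LinearIndependent.of_comp
      ((LinearMap.applyₗ (Finsupp.single (0 : Fin n → ℕ) (1 : k))) ∘ₗ ρ.toLinearMap) ?_
    have : (⇑((LinearMap.applyₗ (Finsupp.single (0 : Fin n → ℕ) (1 : k))) ∘ₗ ρ.toLinearMap) ∘
        fun a : {a : Fin n → ℕ // Adm q a} => mono x a.1) =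
        (fun a => Finsupp.single a (1 : k)) ∘ Subtype.val := by
      ext1 a
      exact key _ a.1 rfl a.2
    rw [this]
    exact (Finsupp.linearIndependent_single_one (R := k) (Fin n → ℕ)).comp _ Subtype.val_injective
  refine ⟨Module.Basis.mk hli ?_, fun a => Module.Basis.mk_apply _ _ _⟩
  rw [← span_mono hx hgen, Submodule.span_le]
  rintro _ ⟨a, rfl⟩
  by_cases ha : Adm q a
  · exact Submodule.subset_span ⟨⟨a, ha⟩, rfl⟩
  · rw [mono_eq_zero hx ha]
    exact zero_mem _

end SkewCommutative

/-! ### The regular representation of the enveloping algebra. -/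

namespace ColorLieAlgebra

open SkewCommutative

variable {k Γ : Type*} [Field k] [AddCommGroup Γ] [DecidableEq Γ] {ε : CommutationFactor k Γ}
  {L : Type*} [AddCommGroup L] [Module k L] {g : ColorLieAlgebra ε L}

/-- Homogeneous elements involve only basis vectors of their own degree, so the commutation
relations on the basis extend bilinearly with the single scalar `ε(α, β)`. -/
theorem IsAbelian.exists_regularRep (hg : g.IsAbelian) {n : ℕ} (x : Module.Basis (Fin n) k L)
    (deg : Fin n → Γ) (hdeg : ∀ α, ∀ a ∈ g.component α, ∀ i, x.repr a i ≠ 0 → deg i = α) :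
    ∃ ρ : g.Envelope →ₐ[k] Module.End k ((Fin n → ℕ) →₀ k),
      ∀ l, ρ (g.envelopeι (x l)) = regularRep (fun i j => (ε.toFun (deg i) (deg j) : k)) l := by
  set q : Fin n → Fin n → k := fun i j => (ε.toFun (deg i) (deg j) : k) with hq_def
  have hq : ∀ i j, q i j * q j i = 1 := fun i j => by
    rw [hq_def, ← Units.val_mul, ε.mul_swap, Units.val_one]
  refine ⟨hg.envelopeLift (x.constr ℕ (regularRep q)) ?_, fun l => ?_⟩
  · intro α β a ha b hb
    rw [x.constr_apply_fintype ℕ, x.constr_apply_fintype ℕ, Finset.sum_mul_sum, Finset.sum_mul_sum,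
      Finset.smul_sum, Finset.sum_comm]
    refine Finset.sum_congr rfl fun j _ => ?_
    rw [Finset.smul_sum]
    refine Finset.sum_congr rfl fun i _ => ?_
    simp only [Module.Basis.equivFun_apply]
    by_cases h : x.repr a i = 0
    · simp [h]
    by_cases h' : x.repr b j = 0
    · simp [h']
    have hij : q i j = ε.toFun α β := by rw [← hdeg α a ha i h, ← hdeg β b hb j h']
    rw [smul_mul_smul_comm, smul_mul_smul_comm, regularRep_mul_comm hq, smul_comm, hij,
      mul_comm (x.repr a i)]
  · rw [hg.envelopeLift_ι, x.constr_basis]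

end ColorLieAlgebra

/-! ### The Koszul complex. -/

namespace SkewCommutative

open MulOpposite GradedKoszul

universe u v

variable {k : Type u} {R : Type v} [Field k] [Ring R] [Algebra k R] {n : ℕ}

/-- The exponents `b` such that the exponents of the even generators (those with `q i i = 1`) are
at most `1`. -/
def CoAdm (q : Fin n → Fin n → k) (b : Fin n → ℕ) : Prop := ∀ i, q i i = 1 → b i ≤ 1

theorem CoAdm.mono {q : Fin n → Fin n → k} {a b : Fin n → ℕ} (h : CoAdm q b) (hab : a ≤ b) :
    CoAdm q a :=
  fun i hi => (hab i).trans (h i hi)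

/-- The generators of the `i`-th module of the Koszul resolution. -/
@[ext]
structure KoszulGen (q : Fin n → Fin n → k) (i : ℕ) : Type v where
  exp : Fin n → ℕ
  coAdm : CoAdm q exp
  sum_eq : ∑ l, exp l = i

instance (q : Fin n → Fin n → k) (i : ℕ) : Finite (KoszulGen.{u, v} q i) := by
  have h : (Set.Iic (fun _ : Fin n => i)).Finite := Set.finite_Iic _
  have := h.to_subtype
  refine Finite.of_injective (β := Set.Iic (fun _ : Fin n => i)) (fun b => ⟨b.exp, fun l => ?_⟩)
    fun b c hbc => KoszulGen.ext (congrArg Subtype.val hbc)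
  exact (Finset.single_le_sum (f := b.exp) (fun _ _ => Nat.zero_le _) (Finset.mem_univ l)).trans_eq
    b.sum_eq

open Classical in
/-- The multiple by `r` of the generator with exponents `b`, or zero if there is none. -/
noncomputable def koszulElem (q : Fin n → Fin n → k) (i : ℕ) (b : Fin n → ℕ) :
    R →ₗ[k] (KoszulGen.{u, v} q i →₀ R) :=
  if h : CoAdm q b ∧ ∑ l, b l = i then Finsupp.lsingle ⟨b, h.1, h.2⟩ else 0

variable {q : Fin n → Fin n → k}

theorem koszulElem_eq_single {i : ℕ} {b : Fin n → ℕ} (hb : CoAdm q b) (hi : ∑ l, b l = i) (r : R) :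
    (koszulElem q i b r : KoszulGen.{u, v} q i →₀ R) = Finsupp.single ⟨b, hb, hi⟩ r := by
  rw [koszulElem, dif_pos ⟨hb, hi⟩]; rfl

theorem koszulElem_of_not {i : ℕ} {b : Fin n → ℕ} (h : ¬ (CoAdm q b ∧ ∑ l, b l = i)) :
    (koszulElem q i b : R →ₗ[k] (KoszulGen.{u, v} q i →₀ R)) = 0 := by
  rw [koszulElem, dif_neg h]

theorem op_smul_koszulElem (i : ℕ) (b : Fin n → ℕ) (r s : R) :
    op s • (koszulElem q i b r : KoszulGen.{u, v} q i →₀ R) = koszulElem q i b (r * s) := by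
  by_cases h : CoAdm q b ∧ ∑ l, b l = i
  · rw [koszulElem_eq_single h.1 h.2, koszulElem_eq_single h.1 h.2, Finsupp.smul_single,
      op_smul_eq_mul]
  · simp [koszulElem_of_not h]

theorem koszulElem_mem_freeDegree {𝒜 : ℕ → Submodule k R} {i j : ℕ} (b : Fin n → ℕ) {r : R}
    (hr : r ∈ 𝒜 j) : koszulElem q i b r ∈
      freeDegree 𝒜 (fun _ : KoszulGen.{u, v} q i => i) (i + j) := by
  by_cases h : CoAdm q b ∧ ∑ l, b l = i
  · rw [koszulElem_eq_single h.1 h.2]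
    exact single_mem_freeDegree (Nat.le_add_right _ _) (by rwa [Nat.add_sub_cancel_left])
  · rw [koszulElem_of_not h]
    exact zero_mem _

variable (q)

/-- The sign-twisted commutation scalars of the Koszul differential. -/
abbrev negq : Fin n → Fin n → k := fun i j => -q i j

/-- The value of the Koszul differential on the multiple by `r` of the generator with
exponents `b`. -/
noncomputable def koszulD₀ (x : Fin n → R) (i : ℕ) (b : Fin n → ℕ) (r : R) :
    KoszulGen.{u, v} q i →₀ R :=
  ∑ l, if b l = 0 then 0 else
    coeff (negq q) l b • koszulElem q i (b - Pi.single l 1) (x l * r)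

/-- The Koszul differential. -/
noncomputable def koszulD (x : Fin n → R) (i : ℕ) :
    (KoszulGen.{u, v} q (i + 1) →₀ R) →ₗ[Rᵐᵒᵖ] (KoszulGen.{u, v} q i →₀ R) :=
  freeLift fun b => koszulD₀ q x i b.exp 1

variable {q}

theorem koszulD_koszulElem (x : Fin n → R) {i : ℕ} {b : Fin n → ℕ} (hb : CoAdm q b)
    (hi : ∑ l, b l = i + 1) (r : R) :
    koszulD q x i (koszulElem q (i + 1) b r) = koszulD₀ q x i b r := by
  rw [koszulElem_eq_single hb hi, koszulD, freeLift_single, koszulD₀, koszulD₀, Finset.smul_sum]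
  refine Finset.sum_congr rfl fun l _ => ?_
  split_ifs
  · exact smul_zero _
  · rw [smul_comm, op_smul_koszulElem, mul_one]

theorem koszulD_mem {𝒜 : ℕ → Submodule k R} [SetLike.GradedMonoid 𝒜] {x : Fin n → R}
    (hx1 : ∀ l, x l ∈ 𝒜 1) (i j : ℕ) :
    ∀ f ∈ freeDegree 𝒜 (fun _ : KoszulGen.{u, v} q (i + 1) => i + 1) j,
      koszulD q x i f ∈ freeDegree 𝒜 (fun _ : KoszulGen.{u, v} q i => i) j := by
  intro f hf
  refine freeLift_mem_freeDegree (fun b => Submodule.sum_mem _ fun l _ => ?_) hf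
  split_ifs
  · exact zero_mem _
  · exact Submodule.smul_mem _ _ (koszulElem_mem_freeDegree _ (by rw [mul_one]; exact hx1 l))

theorem sum_add_single (b : Fin n → ℕ) (l : Fin n) :
    ∑ t, (b + Pi.single l 1 : Fin n → ℕ) t = ∑ t, b t + 1 := by
  simp [Finset.sum_add_distrib]

section Complex

variable {x : Fin n → R} (hx : ∀ i j, x i * x j = q i j • (x j * x i))
include hx

/-- Reordering `x t * x l` gives the factor `q t l`. In the other order `t` is removed while `l` is
still present, which gives `-q t l`. -/
theorem koszulD_comp_aux {l t : Fin n} (hlt : l < t) (c : Fin n → ℕ) (i : ℕ) (r : R) :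
    coeff (negq q) l (c + Pi.single t 1 + Pi.single l 1) •
        coeff (negq q) t (c + Pi.single t 1) •
          (koszulElem q i c (x t * (x l * r)) : KoszulGen.{u, v} q i →₀ R) +
      coeff (negq q) t (c + Pi.single t 1 + Pi.single l 1) •
        coeff (negq q) l (c + Pi.single l 1) • koszulElem q i c (x l * (x t * r)) = 0 := by
  simp only [coeff_add_single, if_pos hlt, if_neg hlt.not_gt, if_neg (lt_irrefl _), mul_one]
  rw [← mul_assoc (x t), hx t l, smul_mul_assoc, map_smul, mul_assoc]
  simp only [smul_smul, ← add_smul]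
  convert zero_smul k _ using 2
  ring

/-- Let `F l t` be the term that removes `l` and then `t`. Terms with `l ≠ t` cancel under the swap;
`F l l` vanishes for even `l` because `b l ≤ 1`, and for odd `l` because `x l * x l = 0`. -/
theorem koszulD_koszulD (i : ℕ) (z : KoszulGen.{u, v} q (i + 1 + 1) →₀ R) :
    koszulD q x i (koszulD q x (i + 1) z) = 0 := by
  refine hom_ext_single (f := koszulD q x i ∘ₗ koszulD q x (i + 1)) (g := 0) (fun b => ?_) z
  obtain ⟨b, hb, hbi⟩ := b
  rw [LinearMap.comp_apply, ← koszulElem_eq_single, koszulD_koszulElem x hb hbi, koszulD₀, map_sum,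
    LinearMap.zero_apply]
  let F : Fin n → Fin n → (KoszulGen.{u, v} q i →₀ R) := fun l t =>
    if b l = 0 then 0 else if (b - Pi.single l 1 : Fin n → ℕ) t = 0 then 0 else
      coeff (negq q) l b • coeff (negq q) t (b - Pi.single l 1) •
        koszulElem q i (b - Pi.single l 1 - Pi.single t 1) (x t * (x l * 1))
  have hF : ∀ l, koszulD q x i (if b l = 0 then 0 else coeff (negq q) l b •
      koszulElem q (i + 1) (b - Pi.single l 1) (x l * 1)) = ∑ t, F l t := by
    intro l
    by_cases hl : b l = 0
    · simp [F, hl]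
    · obtain ⟨c, rfl⟩ := exists_eq_add_single hl
      have hc : ∑ t, c t = i + 1 := by
        rw [sum_add_single] at hbi
        exact Nat.succ_injective hbi
      rw [if_neg hl, ← LinearMap.restrictScalars_apply k, map_smul, LinearMap.restrictScalars_apply,
        add_tsub_cancel_right, koszulD_koszulElem x (hb.mono le_self_add) hc, koszulD₀,
        Finset.smul_sum]
      refine Finset.sum_congr rfl fun t _ => ?_
      simp only [F, if_neg hl, add_tsub_cancel_right]
      split_ifs
      · exact smul_zero _
      · rfl
  rw [Finset.sum_congr rfl fun l _ => hF l, ← Fintype.sum_prod_type' F]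
  have hlt : ∀ l t, l < t → F l t + F t l = 0 := by
    intro l t hlt
    by_cases hl : b l = 0
    · simp [F, hl, hlt.ne]
    by_cases ht : b t = 0
    · simp [F, ht, hlt.ne']
    obtain ⟨c, rfl⟩ := exists_eq_add_single hl
    have ht' : c t ≠ 0 := by simpa [hlt.ne'] using ht
    obtain ⟨c, rfl⟩ := exists_eq_add_single ht'
    have h1 : c + Pi.single t 1 + Pi.single l 1 - Pi.single t 1 = c + Pi.single l 1 := by
      rw [add_right_comm, add_tsub_cancel_right]
    simp only [F, if_neg hl, if_neg ht, h1, add_tsub_cancel_right, if_neg ht']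
    rw [if_neg (by simp), koszulD_comp_aux hx hlt]
  have hdiag : ∀ l, F l l = 0 := by
    intro l
    by_cases hl : q l l = 1
    · have := hb l hl
      have h0 : (b - Pi.single l 1 : Fin n → ℕ) l = 0 := by simp; omega
      simp only [F, h0, if_true, ite_self]
    · simp only [F]
      rw [← mul_assoc, mul_self_eq_zero hx hl, zero_mul, map_zero, smul_zero, smul_zero, ite_self,
        ite_self]
  refine Finset.sum_involution (fun p _ => p.swap) (fun p _ => ?_) (fun p _ hp h => hp ?_)
    (fun _ _ => Finset.mem_univ _) (fun _ _ => Prod.swap_swap _)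
  · rcases lt_trichotomy p.1 p.2 with h | h | h
    · exact hlt _ _ h
    · rw [Prod.fst_swap, Prod.snd_swap, h, hdiag, add_zero]
    · rw [add_comm]; exact hlt _ _ h
  · have : p.2 = p.1 := congrArg Prod.fst h
    rw [this]; exact hdiag _

end Complex

end SkewCommutative

/-! ### The contracting homotopy and exactness. -/

namespace SkewCommutative

open MulOpposite GradedKoszul

universe u v

variable {k : Type u} {R : Type v} [Field k] [Ring R] [Algebra k R] {n : ℕ}

/-- The index `j` is the first one with nonzero exponent. -/
def IsLead (m : Fin n → ℕ) (j : Fin n) : Prop := m j ≠ 0 ∧ ∀ t, t < j → m t = 0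

theorem IsLead.eq {m : Fin n → ℕ} {i j : Fin n} (hi : IsLead m i) (hj : IsLead m j) : i = j := by
  rcases lt_trichotomy i j with h | h | h
  · exact absurd (hj.2 i h) hi.1
  · exact h
  · exact absurd (hi.2 j h) hj.1

theorem exists_isLead {m : Fin n → ℕ} (hm : ∃ t, m t ≠ 0) : ∃ j, IsLead m j := by
  classical
  obtain ⟨t, ht⟩ := hm
  have hne : (Finset.univ.filter fun t => m t ≠ 0).Nonempty := ⟨t, by simpa using ht⟩
  refine ⟨_, (Finset.mem_filter.1 (Finset.min'_mem _ hne)).2, fun s hs => ?_⟩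
  by_contra h
  exact (Finset.min'_le _ s (by simpa using h)).not_gt hs

theorem Adm.add_single {q : Fin n → Fin n → k} {a : Fin n → ℕ} (ha : Adm q a) {l : Fin n}
    (h : q l l ≠ 1 → a l = 0) : Adm q (a + Pi.single l 1) := by
  intro t ht
  by_cases htl : t = l
  · subst htl; simp [h ht]
  · simpa [htl] using ha t ht

theorem CoAdm.add_single {q : Fin n → Fin n → k} {b : Fin n → ℕ} (hb : CoAdm q b) {l : Fin n}
    (h : q l l = 1 → b l = 0) : CoAdm q (b + Pi.single l 1) := by
  intro t ht
  by_cases htl : t = l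
  · subst htl; simp [h ht]
  · simpa [htl] using hb t ht

variable {q : Fin n → Fin n → k} {x : Fin n → R}

open Classical in
/-- The contracting homotopy of the Koszul resolution. -/
noncomputable def koszulH (x : Fin n → R) (B : Module.Basis {a : Fin n → ℕ // Adm q a} k R) (i : ℕ) :
    (KoszulGen.{u, v} q i →₀ R) →ₗ[k] (KoszulGen.{u, v} q (i + 1) →₀ R) :=
  Finsupp.lsum k fun b => B.constr k fun a => ∑ j, if IsLead (a.1 + b.exp) j ∧ a.1 j ≠ 0 then
    koszulElem q (i + 1) (b.exp + Pi.single j 1) (mono x (a.1 - Pi.single j 1)) else 0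

theorem koszulH_koszulElem {B : Module.Basis {a : Fin n → ℕ // Adm q a} k R}
    (hB : ∀ a, B a = mono x a.1) {i : ℕ} {a b : Fin n → ℕ} {j : Fin n} (hb : CoAdm q b)
    (hi : ∑ l, b l = i) (ha : Adm q a) (hj : IsLead (a + b) j) :
    koszulH x B i (koszulElem q i b (mono x a)) = if a j = 0 then 0 else
      koszulElem q (i + 1) (b + Pi.single j 1) (mono x (a - Pi.single j 1)) := by
  classical
  rw [koszulElem_eq_single hb hi, koszulH, Finsupp.lsum_single, ← hB ⟨a, ha⟩, B.constr_basis,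
    Finset.sum_eq_single j]
  · by_cases h : a j = 0 <;> simp [h, hj]
  · intro t _ ht
    exact if_neg fun h => ht (h.1.eq hj)
  · exact fun h => absurd (Finset.mem_univ j) h

section Homotopy

variable (hx : ∀ i j, x i * x j = q i j • (x j * x i))
include hx

theorem koszulD₀_mono (i : ℕ) (b a : Fin n → ℕ) :
    (koszulD₀ q x i b (mono x a) : KoszulGen.{u, v} q i →₀ R) = ∑ l, if b l = 0 then 0 else
      (coeff (negq q) l b * coeff q l a) •
        koszulElem q i (b - Pi.single l 1) (mono x (a + Pi.single l 1)) := by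
  refine Finset.sum_congr rfl fun l _ => ?_
  rw [mul_mono hx, map_smul, smul_smul]

/-- The differential moves one unit from `b` to `a`, so `a + b` and its leading index `j` are the
same for all terms. -/
theorem koszulH_koszulD [∀ a, Decidable (Adm q a)]
    {B : Module.Basis {a : Fin n → ℕ // Adm q a} k R}
    (hB : ∀ a, B a = mono x a.1) {i : ℕ} {a b : Fin n → ℕ} {j : Fin n} (hb : CoAdm q b)
    (hi : ∑ l, b l = i + 1) (hj : IsLead (a + b) j) :
    koszulH x B i (koszulD q x i (koszulElem q (i + 1) b (mono x a))) =
      ∑ l, if b l = 0 then 0 else (coeff (negq q) l b * coeff q l a) •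
        if Adm q (a + Pi.single l 1) then
          if (a + Pi.single l 1 : Fin n → ℕ) j = 0 then 0 else
            koszulElem q (i + 1) (b - Pi.single l 1 + Pi.single j 1)
              (mono x (a + Pi.single l 1 - Pi.single j 1))
        else 0 := by
  rw [koszulD_koszulElem x hb hi, koszulD₀_mono hx, map_sum]
  refine Finset.sum_congr rfl fun l _ => ?_
  by_cases hl : b l = 0
  · rw [if_pos hl, if_pos hl, map_zero]
  rw [if_neg hl, if_neg hl, map_smul]
  by_cases ha : Adm q (a + Pi.single l 1)
  · rw [if_pos ha]
    obtain ⟨c, rfl⟩ := exists_eq_add_single hl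
    rw [sum_add_single] at hi
    rw [add_tsub_cancel_right, koszulH_koszulElem hB (hb.mono le_self_add)
      (Nat.succ_injective hi) ha (j := j)]
    rwa [add_right_comm, add_assoc]
  · rw [if_neg ha, mono_eq_zero hx ha, map_zero, map_zero]

theorem koszul_homotopy_koszulElem
    {B : Module.Basis {a : Fin n → ℕ // Adm q a} k R}
    (hB : ∀ a, B a = mono x a.1) {i : ℕ} {a b : Fin n → ℕ} (hb : CoAdm q b)
    (hi : ∑ l, b l = i + 1) (ha : Adm q a) :
    koszulD q x (i + 1) (koszulH x B (i + 1) (koszulElem q (i + 1) b (mono x a))) +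
      koszulH x B i (koszulD q x i (koszulElem q (i + 1) b (mono x a))) =
        koszulElem q (i + 1) b (mono x a) := by
  classical
  obtain ⟨j, hj⟩ : ∃ j, IsLead (a + b) j := by
    obtain ⟨t, -, ht⟩ := Finset.exists_ne_zero_of_sum_ne_zero (hi.trans_ne i.succ_ne_zero)
    exact exists_isLead ⟨t, by simp [ht]⟩
  have hlow : ∀ t, t < j → a t = 0 ∧ b t = 0 := fun t ht => by
    simpa using hj.2 t ht
  have hjj : a j = 0 → b j ≠ 0 := fun h => by simpa [h] using hj.1
  rw [koszulH_koszulElem hB hb hi ha hj, koszulH_koszulD hx hB hb hi hj]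
  -- In the first case `h` kills `e_b x^a` (if `a j ≠ 0`, then `j` is even and `b j` cannot grow),
  -- and `h d` returns the element through `l = j`. In the second case the summand `l = j` of `d h`
  -- returns it, and the summands `l > j` of `d h` and `h d` cancel: `x_j` contributes `-q l j` to
  -- one and `q l j` to the other.
  by_cases hup : b j ≠ 0 ∧ (q j j ≠ 1 → a j = 0)
  · have htwo : a j ≠ 0 → ∀ c : Fin n → ℕ, c j = b j → ∀ r,
        (koszulElem q (i + 1) (c + Pi.single j 1) r : KoszulGen.{u, v} q (i + 1) →₀ R) = 0 ∧
        (koszulElem q (i + 1 + 1) (c + Pi.single j 1) r :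
          KoszulGen.{u, v} q (i + 1 + 1) →₀ R) = 0 := by
      intro haj c hc r
      have : ¬ CoAdm q (c + Pi.single j 1) := fun h => by
        have := h j (by_contra fun hqj => haj (hup.2 hqj))
        simp only [Pi.add_apply, Pi.single_eq_same, hc] at this
        omega
      rw [koszulElem_of_not fun h => this h.1, koszulElem_of_not fun h => this h.1]
      exact ⟨rfl, rfl⟩
    have h1 : (if a j = 0 then 0 else koszulElem q (i + 1 + 1) (b + Pi.single j 1)
        (mono x (a - Pi.single j 1)) : KoszulGen.{u, v} q (i + 1 + 1) →₀ R) = 0 := by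
      split_ifs with h
      · rfl
      · exact (htwo h b rfl _).2
    rw [h1, map_zero, zero_add, Finset.sum_eq_single j]
    · rw [if_neg hup.1, coeff_eq_one _ fun t ht => (hlow t ht).2,
        coeff_eq_one _ fun t ht => (hlow t ht).1, mul_one, one_smul, if_pos (ha.add_single hup.2),
        if_neg (by simp), add_tsub_cancel_right]
      obtain ⟨c, rfl⟩ := exists_eq_add_single hup.1
      rw [add_tsub_cancel_right]
    · intro l _ hl
      by_cases hbl : b l = 0
      · rw [if_pos hbl]
      rw [if_neg hbl]
      by_cases haj : a j = 0
      · have h : (a + Pi.single l 1 : Fin n → ℕ) j = 0 := by simp [haj, hl.symm]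
        rw [if_pos h, ite_self, smul_zero]
      · rw [(htwo haj (b - Pi.single l 1) (by simp [hl.symm]) _).1, ite_self, ite_self, smul_zero]
    · exact fun h => absurd (Finset.mem_univ j) h
  · have haj : a j ≠ 0 := fun h => hup ⟨hjj h, fun _ => h⟩
    have hqj : q j j = 1 → b j = 0 := fun h => by
      by_contra hbj
      exact hup ⟨hbj, fun h' => absurd h h'⟩
    obtain ⟨c, rfl⟩ := exists_eq_add_single haj
    rw [if_neg haj, add_tsub_cancel_right, koszulD_koszulElem x (hb.add_single hqj)
      (by rw [sum_add_single, hi]), koszulD₀_mono hx, ← Finset.sum_add_distrib,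
      Finset.sum_eq_single j]
    · have hc : ∀ t, t < j → c t = 0 := fun t ht => by
        simpa [ht.ne] using (hlow t ht).1
      have hbs : ∀ t, t < j → (b + Pi.single j 1 : Fin n → ℕ) t = 0 := fun t ht => by
        simpa [ht.ne] using (hlow t ht).2
      rw [if_neg (by simp), coeff_eq_one _ hbs, coeff_eq_one _ hc, mul_one, one_smul,
        add_tsub_cancel_right, add_eq_left]
      by_cases hbj : b j = 0
      · rw [if_pos hbj]
      · have : ¬ Adm q (c + Pi.single j 1 + Pi.single j 1) := fun h => by
          have := h j (mt hqj hbj)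
          simp at this
        rw [if_neg hbj, if_neg this, smul_zero]
    · intro l _ hl
      by_cases hbl : b l = 0
      · rw [if_pos (by simp [hl, hbl]), if_pos hbl, add_zero]
      have hjl : j < l := lt_of_le_of_ne (not_lt.1 fun h => hbl (hlow l h).2) hl.symm
      rw [if_neg (by simp [hbl]), if_neg hbl, coeff_add_single, coeff_add_single, if_pos hjl,
        if_pos hjl]
      obtain ⟨b, rfl⟩ := exists_eq_add_single hbl
      rw [add_right_comm b, add_tsub_cancel_right, add_tsub_cancel_right, add_right_comm c,
        add_tsub_cancel_right]
      by_cases hadm : Adm q (c + Pi.single l 1 + Pi.single j 1)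
      · rw [if_pos hadm, if_neg (by simp), ← add_smul]
        convert zero_smul k _ using 2
        ring
      -- If `j` is odd, then `c j = 0` since `c + δ_j` is admissible; so the failure of
      -- admissibility comes from `l`, and both terms vanish.
      · have : ¬ Adm q (c + Pi.single l 1) := fun h => hadm (h.add_single fun hqj' => by
          have := ha j hqj'
          simp only [Pi.add_apply, Pi.single_eq_same] at this
          simp only [Pi.add_apply, Pi.single_eq_of_ne hl.symm]
          omega)
        rw [if_neg hadm, mono_eq_zero hx this, map_zero, smul_zero, smul_zero, add_zero]
    · exact fun h => absurd (Finset.mem_univ j) h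

/-- This covers positive homological degrees; exactness at `P₀` is proved directly in
`exists_linear_resolution`. -/
theorem koszul_homotopy {B : Module.Basis {a : Fin n → ℕ // Adm q a} k R}
    (hB : ∀ a, B a = mono x a.1) {i : ℕ} (z : KoszulGen.{u, v} q (i + 1) →₀ R) :
    koszulD q x (i + 1) (koszulH x B (i + 1) z) + koszulH x B i (koszulD q x i z) = z := by
  have key : (koszulD q x (i + 1)).restrictScalars k ∘ₗ koszulH x B (i + 1) +
      koszulH x B i ∘ₗ (koszulD q x i).restrictScalars k = LinearMap.id := by
    refine Finsupp.lhom_ext' fun b => B.ext fun a => ?_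
    simp only [LinearMap.comp_apply, LinearMap.add_apply, Finsupp.lsingle_apply,
      LinearMap.restrictScalars_apply, LinearMap.id_apply, hB]
    have := koszul_homotopy_koszulElem hx hB b.coAdm b.sum_eq a.2
    rwa [koszulElem_eq_single b.coAdm b.sum_eq] at this
  exact LinearMap.congr_fun key z

end Homotopy

/-- The Koszul resolution of the trivial module over a skew commutative algebra. -/
theorem exists_linear_resolution {𝒜 : ℕ → Submodule k R} [SetLike.GradedMonoid 𝒜]
    (h𝒜 : ∀ m, 𝒜 (m + 1) = Submodule.span k (Set.range x) * 𝒜 m)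
    (hx1 : ∀ l, x l ∈ 𝒜 1)
    (hx : ∀ i j, x i * x j = q i j • (x j * x i))
    (B : Module.Basis {a : Fin n → ℕ // Adm q a} k R) (hB : ∀ a, B a = mono x a.1) :
    ∃ P : FreeResolution.{u, v, v} 𝒜, ∀ i, Finite (P.gen i) ∧ ∀ y : P.gen i, P.deg i y = i := by
  let aug : (KoszulGen.{u, v} q 0 →₀ R) →ₗ[Rᵐᵒᵖ] (R ⧸ augIdeal 𝒜) :=
    freeLift fun _ => Submodule.Quotient.mk 1
  have h0 : CoAdm q (0 : Fin n → ℕ) := fun _ _ => Nat.zero_le _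
  have h0s : ∑ l, (0 : Fin n → ℕ) l = 0 := by simp
  let e : KoszulGen.{u, v} q 0 := ⟨0, h0, h0s⟩
  have he : ∀ y, y = e := fun y => by
    ext l
    exact Finset.sum_eq_zero_iff.1 y.sum_eq l (Finset.mem_univ l)
  have hz : ∀ z : KoszulGen.{u, v} q 0 →₀ R, z = Finsupp.single e (z e) := fun z => by
    ext y
    rw [he y, Finsupp.single_eq_same]
  have haug : ∀ r, aug (Finsupp.single e r) = Submodule.Quotient.mk r := fun r => by
    rw [freeLift_single, ← Submodule.Quotient.mk_smul, op_smul_eq_mul, one_mul]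
  have hexact : Function.Exact (koszulD q x 0) aug := by
    intro z
    constructor
    · intro h
      rw [hz z, haug, Submodule.Quotient.mk_eq_zero] at h
      let ψ : R →ₗ[Rᵐᵒᵖ] (KoszulGen.{u, v} q 0 →₀ R) := Finsupp.lsingle e
      -- By `h𝒜`, positive degree elements are sums of products `x l * t`, and such a product is the
      -- image of `e_(δ_l) t`.
      have hle : augIdeal 𝒜 ≤ (LinearMap.range (koszulD q x 0)).comap ψ := by
        refine Submodule.span_le.2 ?_
        rintro r ⟨m, hm, hr⟩
        obtain ⟨m, rfl⟩ := Nat.exists_eq_succ_of_ne_zero hm.ne'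
        rw [Nat.succ_eq_add_one, h𝒜] at hr
        induction hr using Submodule.mul_induction_on' with
        | mem_mul_mem s hs t ht =>
          induction hs using Submodule.span_induction with
          | mem s hs =>
            obtain ⟨l, rfl⟩ := hs
            have hc : CoAdm q (0 + Pi.single l 1) := h0.add_single fun _ => rfl
            refine ⟨koszulElem q 1 (0 + Pi.single l 1) t, ?_⟩
            rw [koszulD_koszulElem x hc (by rw [sum_add_single, h0s]), koszulD₀,
              Finset.sum_eq_single l]
            · rw [if_neg (by simp), coeff_eq_one _ fun t ht => by simp [ht.ne], one_smul,
                add_tsub_cancel_right, koszulElem_eq_single h0 h0s]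
              rfl
            · intro t _ ht
              rw [if_pos (by simp [ht])]
            · exact fun h => absurd (Finset.mem_univ l) h
          | zero => rw [zero_mul]; exact zero_mem _
          | add s s' _ _ hs hs' => rw [add_mul]; exact add_mem hs hs'
          | smul c s _ hs =>
            rw [smul_mul_assoc]
            exact Submodule.smul_mem (((LinearMap.range (koszulD q x 0)).comap ψ).restrictScalars k)
              c hs
        | add s _ t _ hs ht => exact add_mem hs ht
      rw [hz z]
      exact hle h
    · rintro ⟨w, rfl⟩
      refine hom_ext_single (f := aug ∘ₗ koszulD q x 0) (g := 0) (fun b => ?_) w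
      rw [LinearMap.comp_apply, ← koszulElem_eq_single b.coAdm b.sum_eq,
        koszulD_koszulElem x b.coAdm b.sum_eq, koszulD₀, map_sum, LinearMap.zero_apply]
      refine Finset.sum_eq_zero fun l _ => ?_
      split_ifs
      · exact map_zero _
      · rw [← map_smul, hz (koszulElem _ _ _ _), haug, Submodule.Quotient.mk_eq_zero]
        refine mem_augIdeal_of_mem one_pos ?_
        by_cases hb : CoAdm q (b.exp - Pi.single l 1) ∧
            ∑ t, (b.exp - Pi.single l 1 : Fin n → ℕ) t = 0
        · rw [koszulElem_eq_single hb.1 hb.2, he ⟨_, hb.1, hb.2⟩, Finsupp.single_eq_same, mul_one]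
          exact Submodule.smul_mem _ _ (hx1 l)
        · rw [koszulElem_of_not hb]
          exact zero_mem _
  refine ⟨{ gen := KoszulGen.{u, v} q
            deg := fun i _ => i
            d := koszulD q x
            aug := aug
            d_mem := koszulD_mem hx1
            aug_mem := fun j f hf => ⟨f e, by simpa using hf e, by rw [← haug, ← hz]⟩
            aug_surjective := fun y => ?_
            exact_aug := hexact
            exact_d := fun i z => ⟨fun h => ⟨koszulH x B (i + 1) z, ?_⟩, ?_⟩ },
    fun i => ⟨inferInstance, fun _ => rfl⟩⟩
  · obtain ⟨r, rfl⟩ := Submodule.Quotient.mk_surjective _ y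
    exact ⟨_, haug r⟩
  · have := koszul_homotopy hx hB z
    rwa [h, map_zero, add_zero] at this
  · rintro ⟨w, rfl⟩
    exact koszulD_koszulD hx i w

end SkewCommutative

/-! ### Koszulity of the enveloping algebra. -/

theorem mainTheorem5 {k Γ L : Type*} [Field k] (h2 : ringChar k ≠ 2) (h3 : ringChar k ≠ 3)
    [AddCommGroup Γ] [DecidableEq Γ] (ε : CommutationFactor k Γ)
    [AddCommGroup L] [Module k L] [FiniteDimensional k L]
    (g : ColorLieAlgebra ε L) (hg : g.IsAbelian) :
    GradedKoszul.IsHomogeneousKoszul g.envelopeDegree := by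
  obtain ⟨n, b, deg, hdeg, hdeg'⟩ := g.exists_homogeneous_basis
  obtain ⟨ρ, hρ⟩ := hg.exists_regularRep b deg hdeg'
  let q : Fin n → Fin n → k := fun i j => ε.toFun (deg i) (deg j)
  let x : Fin n → g.Envelope := fun i => g.envelopeι (b i)
  have hq : ∀ i j, q i j * q j i = 1 := fun i j => by
    rw [← Units.val_mul, ε.mul_swap, Units.val_one]
  have hx : ∀ i j, x i * x j = q i j • (x j * x i) := fun i j =>
    hg.envelopeι_mul_comm (hdeg i) (hdeg j)
  have hspan : Submodule.span k (Set.range x) = LinearMap.range g.envelopeι := by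
    rw [LinearMap.range_eq_map, ← b.span_eq, Submodule.map_span, ← Set.range_comp]
    rfl
  have hgen : Algebra.adjoin k (Set.range x) = ⊤ := by
    rw [← Algebra.adjoin_span, hspan, LinearMap.coe_range, g.adjoin_range_envelopeι]
  obtain ⟨B, hB⟩ := SkewCommutative.exists_basis hq hx hgen ρ hρ
  obtain ⟨Q, hQ⟩ := SkewCommutative.exists_linear_resolution (𝒜 := g.envelopeDegree)
    (fun m => by rw [hspan, ColorLieAlgebra.envelopeDegree, pow_succ']; rfl)
    (fun l => g.envelopeι_mem_envelopeDegree (b l)) hx B hB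
  exact ⟨hg.isStandard_envelopeDegree, ⟨Q, hQ⟩, fun P _ _ hij =>
    P.subsingleton_tor hg.isInternal_envelopeDegree Q (fun i => (hQ i).2) hij⟩
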